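/- **Market.** Let $S$ and $C$ be finite sets of students and colleges and $X\subseteq S\times C$ a set of contracts. For $Y\subseteq X$ write $Y_s$, $Y_c$ for the contracts of $Y$ that involve $s$, $c$, and $\nu(Y)=(|Y_c|)_{c\in C}$. Every student $s$ has a strict preference $\succ_s$ over $X_s\cup\{(s,\emptyset)\}$ and every college $c$ a strict preference $\succ_c$ over $X_c\cup\{(\emptyset,c)\}$, where $\emptyset$ means being unmatched; every contract is acceptable for its college, and $(s,c)\in X$ is acceptable for $s$ if $(s,c)\succ_s(s,\emptyset)$. Distributional constraints are given by $f:\mathbb Z_{\ge 0}^C\to\{-\infty,0\}$, which is *hereditary*: its set of induced vectors $\{\nu: f(\nu)=0\}$ contains $0$ and contains every $\nu'<\nu$ when it contains $\nu$. The master-list $L$ is a strict ordering of all students. The contracts carry pairwise distinct, strictly positive weights $w$ with $w((s,c))>w((s',c))$ whenever $(s,c)\succ_c(s',c)$. A *matching* is a set $Y\subseteq X$ such that for each $s$, $Y_s$ is empty or consists of one contract, acceptable for $s$. In $Y$, student $s$ *has justified envy* toward $s'$ if for some college $c$, $(s,c)\in X$ is acceptable for $s$, $s$ prefers $(s,c)$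 to $Y_s$ (to being unmatched, if $Y_s=\emptyset$), $(s',c)\in Y$, and $(s,c)\succ_c(s',c)$. A matching $Y$ is *ML-fair* if, whenever $s$ has justified envy toward $s'$ in $Y$, $s'$ precedes $s$ in $L$. **GDA.** For $Y\subseteq X$ let $Ch_S(Y)$ consist of the most preferred acceptable contract of each student in $Y_s$ (if any), and, for a constraint function $g$, let $Ch_C(Y)$ be the maximizer of $g(\nu(Z))+\sum_{x\in Z}w(x)$ over $Z\subseteq Y$. GDA based on $g$ for a set $T$ of students starts with $Re=\emptyset$ and repeats: let $Y=Ch_S\big((\bigcup_{s\in T}X_s)\setminus Re\big)$ and $Z=Ch_C(Y)$; if $Z=Y$, return $Y$; otherwise add $Y\setminus Z$ to $Re$. **MS-GDA.** Start with $Y=\emptyset$. While students remain in $L$, put $f_k(\nu)=f(\nu+\nu(Y))$, and for a positive integer $d$ let $f_k^d(\nu)=f_k(\nu)$ if $|\nu|=\sum_c\nu_c\le d$ and $f_k^d(\nu)=-\infty$ otherwise. Choose any positive integer $d$ for which $F=\{\nu:f_k^d(\nu)=0\}$ is M$^\natural$-convex, i.e., for all $\nu,\nu'\in F$ and $i$ with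 $\nu_i>\nu'_i$ there is $j\in\{0\}\cup\{l:\nu_l<\nu'_l\}$ with $\nu-e_i+e_j\in F$ and $\nu'+e_i-e_j\in F$, where $e_i$ is the $i$-th unit vector and $e_0=0$. Remove the top $d$ students from $L$ (all remaining ones, if fewer than $d$ remain), and add to $Y$ the result of GDA based on $f_k^d$ for them. When no student remains, return $Y$. **Theorem.** MS-GDA is ML-fair: for every such market, weights and master-list, and for every admissible choice of the integers $d$ in the stages, the output $Y$ of MS-GDA is a matching, and whenever a student $s$ has justified envy toward a student $s'$ in $Y$, $s'$ precedes $s$ in $L$. -/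

import Mathlib

/-- `r` is a strict linear order on the set `A` (values of `r` outside `A` are irrelevant). -/
def StrictLinearOn {α : Type*} (r : α → α → Prop) (A : Set α) : Prop :=
  (∀ a ∈ A, ¬ r a a) ∧
  (∀ a ∈ A, ∀ b ∈ A, ∀ c ∈ A, r a b → r b c → r a c) ∧
  (∀ a ∈ A, ∀ b ∈ A, a ≠ b → r a b ∨ r b a)

/-- A matching market under distributional constraints with students `S` and colleges `C`.
In a preference relation, `some c` (resp. `some s`) stands for the contract with `c` (resp. `s`)
and `none` for being unmatched; `sPref s a b` means `a ≻_s b` and `cPref c a b` means `a ≻_c b`. -/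
structure Market (S C : Type*) where
  /-- the set of contracts -/
  X : Finset (S × C)
  sPref : S → Option C → Option C → Prop
  cPref : C → Option S → Option S → Prop
  sPref_strict : ∀ s, StrictLinearOn (sPref s) {o | ∀ c, o = some c → (s, c) ∈ X}
  cPref_strict : ∀ c, StrictLinearOn (cPref c) {o | ∀ s, o = some s → (s, c) ∈ X}
  /-- every contract is acceptable for its college -/
  cPref_acceptable : ∀ s c, (s, c) ∈ X → cPref c (some s) none
  /-- the distributional constraints, a function with values in `{-∞, 0}` -/
  f : (C → ℕ) → EReal
  f_values : ∀ ν, f ν = ⊥ ∨ f ν = 0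

/-- The induced vectors of `f`. -/
def inducedVectors {C : Type*} (f : (C → ℕ) → EReal) : Set (C → ℕ) :=
  {ν | f ν = 0}

/-- Heredity of a family of vectors. -/
def IsHereditary {C : Type*} (F : Set (C → ℕ)) : Prop :=
  0 ∈ F ∧ ∀ ν ν' : C → ℕ, ν' < ν → ν ∈ F → ν' ∈ F

/-- M♮-convexity of a family of vectors; the first alternative is the choice `e_0 = 0`.
All subtractions are exact, since `ν i > 0` and, in the second alternative, `ν' j > 0`, `j ≠ i`. -/
def IsMNatConvex {C : Type*} [DecidableEq C] (F : Set (C → ℕ)) : Prop :=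
  ∀ ν ∈ F, ∀ ν' ∈ F, ∀ i, ν' i < ν i →
    (ν - Pi.single i 1 ∈ F ∧ ν' + Pi.single i 1 ∈ F) ∨
    ∃ j, ν j < ν' j ∧ ν - Pi.single i 1 + Pi.single j 1 ∈ F ∧
      ν' + Pi.single i 1 - Pi.single j 1 ∈ F

/-- The vector `ν(Y)` of the numbers of contracts of `Y` at each college. -/
def countVec {S C : Type*} [DecidableEq C] (Y : Finset (S × C)) : C → ℕ :=
  fun c => (Y.filter (fun x => x.2 = c)).card

/-- The function `f^d`: equal to `f` on vectors of size at most `d`, and `-∞` elsewhere. -/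
noncomputable def truncate {C : Type*} [Fintype C] (f : (C → ℕ) → EReal) (d : ℕ) :
    (C → ℕ) → EReal :=
  fun ν => if ∑ c, ν c ≤ d then f ν else ⊥

/-- The function `ν ↦ f (ν + ν(Y))`. -/
def residualConstraint {S C : Type*} [DecidableEq C] (f : (C → ℕ) → EReal) (Y : Finset (S × C)) :
    (C → ℕ) → EReal :=
  fun ν => f (ν + countVec Y)

/-- The objective `f(ν(Y)) + w(Y)` of the colleges' choice function. -/
noncomputable def objective {S C : Type*} [DecidableEq C] (f : (C → ℕ) → EReal)
    (w : S × C → ℝ) (Y : Finset (S × C)) : EReal :=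
  f (countVec Y) + ((∑ x ∈ Y, w x : ℝ) : EReal)

theorem exists_isArgmax {S C : Type*} [DecidableEq C] (f : (C → ℕ) → EReal)
    (w : S × C → ℝ) (Y : Finset (S × C)) :
    ∃ Z, Z ⊆ Y ∧ ∀ Z', Z' ⊆ Y → objective f w Z' ≤ objective f w Z := by
  obtain ⟨Z, hZ, hmax⟩ := Finset.exists_max_image Y.powerset (objective f w)
    ⟨∅, Finset.empty_mem_powerset Y⟩
  exact ⟨Z, Finset.mem_powerset.1 hZ, fun Z' hZ' => hmax Z' (Finset.mem_powerset.2 hZ')⟩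

/-- The colleges' choice function `Ch_C(Y) = argmax_{Z ⊆ Y} f(ν(Z)) + w(Z)`. -/
noncomputable def chC {S C : Type*} [DecidableEq C] (f : (C → ℕ) → EReal)
    (w : S × C → ℝ) (Y : Finset (S × C)) : Finset (S × C) :=
  (exists_isArgmax f w Y).choose

theorem chC_subset {S C : Type*} [DecidableEq C] (f : (C → ℕ) → EReal)
    (w : S × C → ℝ) (Y : Finset (S × C)) : chC f w Y ⊆ Y :=
  (exists_isArgmax f w Y).choose_spec.1

namespace Market

/-- The contract `(s, c)` exists and is acceptable for `s`. -/
def Acceptable {S C : Type*} (M : Market S C) (s : S) (c : C) : Prop :=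
  (s, c) ∈ M.X ∧ M.sPref s (some c) none

/-- Weights of the contracts: strictly positive, pairwise distinct, respecting the preferences of
the colleges. -/
def IsWeight {S C : Type*} (M : Market S C) (w : S × C → ℝ) : Prop :=
  (∀ x ∈ M.X, 0 < w x) ∧
  (∀ x ∈ M.X, ∀ y ∈ M.X, w x = w y → x = y) ∧
  (∀ s s' c, (s, c) ∈ M.X → (s', c) ∈ M.X → M.cPref c (some s) (some s') →
    w (s', c) < w (s, c))

/-- The students' choice function `Ch_S(Y)`: for every student, the most preferred contract of
`Y` that involves the student and is acceptable for the student, if there is one. -/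
noncomputable def chS {S C : Type*} (M : Market S C) (Y : Finset (S × C)) : Finset (S × C) :=
  open Classical in
  Y.filter (fun x => M.Acceptable x.1 x.2 ∧
    ∀ c, (x.1, c) ∈ Y → M.Acceptable x.1 c → c = x.2 ∨ M.sPref x.1 (some x.2) (some c))

theorem chS_subset {S C : Type*} (M : Market S C) (Y : Finset (S × C)) : M.chS Y ⊆ Y := by
  classical
  exact Finset.filter_subset _ _

/-- Generalized Deferred Acceptance on the contracts `A`, run from the state in which the contracts
`Re` have been rejected. -/
noncomputable def gdaFrom {S C : Type*} [DecidableEq S] [DecidableEq C] (M : Market S C)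
    (f : (C → ℕ) → EReal) (w : S × C → ℝ) (A Re : Finset (S × C)) : Finset (S × C) :=
  if chC f w (M.chS (A \ Re)) = M.chS (A \ Re) then
    M.chS (A \ Re)
  else
    gdaFrom M f w A (Re ∪ (M.chS (A \ Re) \ chC f w (M.chS (A \ Re))))
termination_by (A \ Re).card
decreasing_by
  rename_i h
  have hne : (M.chS (A \ Re) \ chC f w (M.chS (A \ Re))).Nonempty := by
    rw [Finset.nonempty_iff_ne_empty, Ne, Finset.sdiff_eq_empty_iff_subset]
    exact fun h' => h (Finset.Subset.antisymm (chC_subset _ _ _) h')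
  obtain ⟨x, hx⟩ := hne
  have hxA : x ∈ A \ Re := M.chS_subset _ (Finset.mem_sdiff.1 hx).1
  apply Finset.card_lt_card
  refine Finset.ssubset_iff_subset_ne.2
    ⟨Finset.sdiff_subset_sdiff (Finset.Subset.refl _) Finset.subset_union_left, fun he => ?_⟩
  rw [← he] at hxA
  exact (Finset.mem_sdiff.1 hxA).2 (Finset.mem_union_right _ hx)

/-- The matching obtained by Generalized Deferred Acceptance (GDA) for the students in the list `T`,
based on the constraint function `f`. -/
noncomputable def gda {S C : Type*} [DecidableEq S] [DecidableEq C] (M : Market S C)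
    (f : (C → ℕ) → EReal) (w : S × C → ℝ) (T : List S) : Finset (S × C) :=
  M.gdaFrom f w (M.X.filter (fun x => x.1 ∈ T)) ∅

/-- `M.MSGDAFrom w L Y Y'`: the stages of MS-GDA, run from a state where `L` is the list of remaining
students and `Y` the current set of contracts, can return `Y'`. In a stage, the current function
`f_k` is `residualConstraint M.f Y`, and `d` is any positive integer for which `f_k^d` induces an M♮-convex
set; if fewer than `d` students remain, all of them are assigned. -/
inductive MSGDAFrom {S C : Type*} [DecidableEq S] [Fintype C] [DecidableEq C] (M : Market S C)
    (w : S × C → ℝ) : List S → Finset (S × C) → Finset (S × C) → Prop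
  | terminate (Y : Finset (S × C)) : MSGDAFrom M w [] Y Y
  | stage (L : List S) (Y Y' : Finset (S × C)) (d : ℕ) (hL : L ≠ []) (hd : 0 < d)
      (hconv : IsMNatConvex (inducedVectors (truncate (residualConstraint M.f Y) d)))
      (next : MSGDAFrom M w (L.drop d)
        (Y ∪ M.gda (truncate (residualConstraint M.f Y) d) w (L.take d)) Y') :
      MSGDAFrom M w L Y Y'

/-- `Y` is an output of MS-GDA with master-list `L`, for some choice of the numbers `d`. -/
def IsMSGDAOutput {S C : Type*} [DecidableEq S] [Fintype C] [DecidableEq C] (M : Market S C)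
    (w : S × C → ℝ) (L : List S) (Y : Finset (S × C)) : Prop :=
  M.MSGDAFrom w L ∅ Y

/-- `Y` is a matching: every student has no contract, or exactly one, which is acceptable. -/
def IsMatching {S C : Type*} [DecidableEq S] (M : Market S C) (Y : Finset (S × C)) : Prop :=
  Y ⊆ M.X ∧ ∀ s, Y.filter (fun x => x.1 = s) = ∅ ∨
    ∃ c, Y.filter (fun x => x.1 = s) = {(s, c)} ∧ M.Acceptable s c

/-- `(s, c) ≻_s Y_s`. -/
def PrefersTo {S C : Type*} [DecidableEq S] (M : Market S C) (s : S) (c : C)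
    (Y : Finset (S × C)) : Prop :=
  (∃ c', Y.filter (fun x => x.1 = s) = {(s, c')} ∧ M.sPref s (some c) (some c')) ∨
  (Y.filter (fun x => x.1 = s) = ∅ ∧ M.sPref s (some c) none)

/-- Student `s` has justified envy toward student `s'` in `Y`. -/
def JustifiedEnvy {S C : Type*} [DecidableEq S] (M : Market S C) (Y : Finset (S × C))
    (s s' : S) : Prop :=
  ∃ c, M.Acceptable s c ∧ M.PrefersTo s c Y ∧ (s', c) ∈ Y ∧ M.cPref c (some s) (some s')

/-- ML-fairness of `Y`: justified envy is only toward students that are earlier in the list `L`. -/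
def MLFair {S C : Type*} [DecidableEq S] (M : Market S C) (L : List S)
    (Y : Finset (S × C)) : Prop :=
  ∀ s s', M.JustifiedEnvy Y s s' → L.idxOf s' < L.idxOf s

end Market

/-! Within a stage, rejections are never regretted. Call a contract x at c blocked by Z if the
contracts of Z heavier than x, with one more unit at c, are infeasible. A maximum-weight choice
blocks what it rejects (`IsMaxWeight.blocked`), and M♮-exchange carries blocking by a feasible set
over to the choice from any set containing it (`IsMaxWeight.blocked_of_blocked`). So everything GDA
rejects is blocked by a subset Z of its outcome R (`gdaFrom_spec`).

If R held a contract at c lighter than x, the heavier part of Z could be extended by it, by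
heredity; so there is no envy inside a stage. Moreover, Z was chosen in a round with a rejection, so
|Z| < d and the bound d is not what blocks: c is full under f_k itself, and by heredity no later
stage adds to c. Only envy toward earlier stages remains. -/

theorem IsHereditary.mono {C : Type*} {F : Set (C → ℕ)} (hF : IsHereditary F) {ν ν' : C → ℕ}
    (h : ν' ≤ ν) (hν : ν ∈ F) : ν' ∈ F := by
  rcases h.lt_or_eq with h | h
  · exact hF.2 ν ν' h hν
  · exact h ▸ hν

/-! ### Count vectors of sets of contracts. -/

section countVec

variable {S C : Type*} [DecidableEq C]

theorem countVec_mono {Y Z : Finset (S × C)} (h : Y ⊆ Z) : countVec Y ≤ countVec Z :=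
  fun _ => Finset.card_le_card (Finset.filter_subset_filter _ h)

@[simp] theorem countVec_empty : countVec (∅ : Finset (S × C)) = 0 := by
  ext c; simp [countVec]

theorem sum_countVec [Fintype C] (Y : Finset (S × C)) : ∑ c, countVec Y c = Y.card :=
  (Finset.card_eq_sum_card_fiberwise (f := fun x : S × C => x.2) (t := Finset.univ)
    (by simp)).symm

variable [DecidableEq S]

theorem countVec_insert {Y : Finset (S × C)} {x : S × C} (hx : x ∉ Y) :
    countVec (insert x Y) = countVec Y + Pi.single x.2 1 := by
  ext c
  by_cases h : x.2 = c
  · subst h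
    simp [countVec, Finset.filter_insert, hx]
  · simp [countVec, Finset.filter_insert, h]

theorem countVec_erase {Y : Finset (S × C)} {x : S × C} (hx : x ∈ Y) :
    countVec (Y.erase x) = countVec Y - Pi.single x.2 1 := by
  have h := countVec_insert (Finset.notMem_erase x Y)
  rw [Finset.insert_erase hx] at h
  rw [h, add_tsub_cancel_right]

theorem countVec_union {Y Z : Finset (S × C)} (h : Disjoint Y Z) :
    countVec (Y ∪ Z) = countVec Y + countVec Z := by
  ext c
  simp only [countVec, Finset.filter_union, Pi.add_apply]
  exact Finset.card_union_of_disjoint (Finset.disjoint_filter_filter h)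

theorem exists_mem_of_countVec_lt {Y Z : Finset (S × C)} {c : C}
    (h : countVec Y c < countVec Z c) : ∃ z ∈ Z, z ∉ Y ∧ z.2 = c := by
  by_contra! hcon
  refine h.not_ge (Finset.card_le_card fun z hz => ?_)
  rw [Finset.mem_filter] at hz ⊢
  exact ⟨by_contra fun hzY => hcon z hz.1 hzY hz.2, hz.2⟩

end countVec

/-! ### Maximum-weight choice and blocking. -/

section choice

variable {S C : Type*} [DecidableEq C]

/-- `Z` is a subset of `Y` of maximal weight among those with count vector in `F`. -/
def IsMaxWeight (F : Set (C → ℕ)) (w : S × C → ℝ) (Y Z : Finset (S × C)) : Prop :=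
  Z ⊆ Y ∧ countVec Z ∈ F ∧
    ∀ Z' ⊆ Y, countVec Z' ∈ F → ∑ x ∈ Z', w x ≤ ∑ x ∈ Z, w x

theorem isMaxWeight_chC {g : (C → ℕ) → EReal} (hg : ∀ ν, g ν = ⊥ ∨ g ν = 0)
    (h0 : g 0 = 0) (w : S × C → ℝ) (Y : Finset (S × C)) :
    IsMaxWeight (inducedVectors g) w Y (chC g w Y) := by
  have hmax : ∀ Z' ⊆ Y, objective g w Z' ≤ objective g w (chC g w Y) :=
    (exists_isArgmax g w Y).choose_spec.2
  have hfeas : g (countVec (chC g w Y)) = 0 := by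
    -- The empty set has objective 0, so -∞ is not maximal.
    refine (hg _).resolve_left fun h => ?_
    have := hmax ∅ (Finset.empty_subset _)
    simp [objective, h, h0] at this
  refine ⟨chC_subset g w Y, hfeas, fun Z' hZ' hF => ?_⟩
  have h1 := hmax Z' hZ'
  rw [objective, objective, hfeas, show g (countVec Z') = 0 from hF, zero_add, zero_add] at h1
  exact_mod_cast h1

variable [DecidableEq S] {F : Set (C → ℕ)} {w : S × C → ℝ} {Y Z : Finset (S × C)}

theorem IsMaxWeight.le_of_exchange (h : IsMaxWeight F w Y Z) {x z : S × C} (hx : x ∈ Y)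
    (hxZ : x ∉ Z) (hz : z ∈ Z) (hF : countVec (insert x (Z.erase z)) ∈ F) : w x ≤ w z := by
  have h1 := h.2.2 _ (Finset.insert_subset hx ((Finset.erase_subset _ _).trans h.1)) hF
  rw [Finset.sum_insert (fun hm => hxZ (Finset.mem_of_mem_erase hm))] at h1
  have h2 := Finset.add_sum_erase Z w hz
  linarith

/-- A rejected contract is blocked by the accepted contracts of larger weight. -/
theorem IsMaxWeight.blocked (h : IsMaxWeight F w Y Z) (hconv : IsMNatConvex F)
    (hpos : ∀ x ∈ Y, 0 < w x) (hinj : ∀ x ∈ Y, ∀ y ∈ Y, w x = w y → x = y)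
    {x : S × C} (hx : x ∈ Y) (hxZ : x ∉ Z) :
    countVec (Z.filter fun z => w x < w z) + Pi.single x.2 1 ∉ F := by
  intro hF
  -- Weights are distinct and `x ∉ Z`, so what `Z` has beyond its part heavier than `x` is lighter
  -- than `x`.
  have hlt : ∀ {c}, countVec (Z.filter fun z => w x < w z) c < countVec Z c →
      ∃ z ∈ Z, z.2 = c ∧ w z < w x := by
    intro c hc
    obtain ⟨z, hz, hzn, hzc⟩ := exists_mem_of_countVec_lt hc
    refine ⟨z, hz, hzc, lt_of_le_of_ne ?_ fun he => ?_⟩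
    · by_contra! hgt
      exact hzn (Finset.mem_filter.2 ⟨hz, hgt⟩)
    · exact hxZ (hinj z (h.1 hz) x hx he ▸ hz)
  have hswap : ∀ z ∈ Z, countVec (insert x (Z.erase z)) =
      countVec Z - Pi.single z.2 1 + Pi.single x.2 1 := fun z hz => by
    rw [countVec_insert (fun hm => hxZ (Finset.mem_of_mem_erase hm)), countVec_erase hz]
  -- A lighter contract of `Z` at the college of `x` could be traded for `x` without changing the
  -- count vector.
  by_cases hc : countVec (Z.filter fun z => w x < w z) x.2 < countVec Z x.2
  · obtain ⟨z, hz, hzc, hw⟩ := hlt hc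
    refine (h.le_of_exchange hx hxZ hz ?_).not_gt hw
    rw [hswap z hz, hzc, tsub_add_cancel_of_le]
    · exact h.2.1
    · intro j
      by_cases hj : j = x.2
      · subst hj; simp; omega
      · simp [Pi.single_eq_of_ne hj]
  -- Otherwise exchange at this college lets `Z` take `x`, either outright or for a lighter contract
  -- elsewhere; both gain weight.
  · rcases hconv _ hF _ h.2.1 x.2 (by simp; omega) with ⟨-, h1⟩ | ⟨j, hj, -, h1⟩
    · rw [← countVec_insert hxZ] at h1
      have h2 := h.2.2 _ (Finset.insert_subset hx h.1) h1
      rw [Finset.sum_insert hxZ] at h2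
      linarith [hpos x hx]
    · have hjx : j ≠ x.2 := by
        rintro rfl
        simp at hj; omega
      rw [Pi.add_apply, Pi.single_eq_of_ne hjx, add_zero] at hj
      obtain ⟨z, hz, rfl, hw⟩ := hlt hj
      refine (h.le_of_exchange hx hxZ hz ?_).not_gt hw
      rw [hswap z hz]
      convert h1 using 1
      ext c
      by_cases hcz : c = z.2
      · subst hcz
        simp [Pi.single_eq_of_ne hjx]
      · simp [Pi.single_eq_of_ne hcz]

/-- Blocking by contracts of weight above `θ` is inherited by the choice from a larger set. -/
theorem IsMaxWeight.blocked_of_blocked (h : IsMaxWeight F w Y Z) (hF : IsHereditary F)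
    (hconv : IsMNatConvex F) (hpos : ∀ x ∈ Y, 0 < w x)
    (hinj : ∀ x ∈ Y, ∀ y ∈ Y, w x = w y → x = y) {G : Finset (S × C)} {θ : ℝ} {c : C}
    (hG : G ⊆ Y) (hGθ : ∀ y ∈ G, θ < w y) (hGF : countVec G ∈ F)
    (hblock : countVec G + Pi.single c 1 ∉ F) :
    countVec (Z.filter fun z => θ < w z) + Pi.single c 1 ∉ F := by
  -- A contract of `G` missing from `Z` was rejected, hence is blocked by heavier contracts, all of
  -- weight above `θ`.
  have key : ∀ j, countVec (Z.filter fun z => θ < w z) j < countVec G j →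
      countVec (Z.filter fun z => θ < w z) + Pi.single j 1 ∉ F := by
    intro j hj hjF
    obtain ⟨y, hy, hyn, rfl⟩ := exists_mem_of_countVec_lt hj
    have hyZ : y ∉ Z := fun hm => hyn (Finset.mem_filter.2 ⟨hm, hGθ y hy⟩)
    refine h.blocked hconv hpos hinj (hG hy) hyZ (hF.mono ?_ hjF)
    refine add_le_add_left (countVec_mono fun z hz => ?_) _
    rw [Finset.mem_filter] at hz ⊢
    exact ⟨hz.1, (hGθ y hy).trans hz.2⟩
  intro hcF
  by_cases hc : countVec (Z.filter fun z => θ < w z) c < countVec G c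
  · exact key c hc hcF
  -- Exchange at `c` either gives `G` a further unit there, against `hblock`, or moves the unit to a
  -- college where `G` has more, against `key`.
  · rcases hconv _ hcF _ hGF c (by simp; omega) with ⟨-, h1⟩ | ⟨j, hj, h1, -⟩
    · exact hblock h1
    · rw [add_tsub_cancel_right] at h1
      exact key j (lt_of_le_of_lt (by simp) hj) h1

end choice

/-! ### Heredity of truncated and residual constraints. -/

section constraints

theorem truncate_values {C : Type*} [Fintype C] {f : (C → ℕ) → EReal}
    (hf : ∀ ν, f ν = ⊥ ∨ f ν = 0) (d : ℕ) (ν : C → ℕ) :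
    truncate f d ν = ⊥ ∨ truncate f d ν = 0 := by
  unfold truncate
  split_ifs
  · exact hf ν
  · exact Or.inl rfl

theorem mem_inducedVectors_truncate {C : Type*} [Fintype C] {f : (C → ℕ) → EReal} {d : ℕ}
    {ν : C → ℕ} : ν ∈ inducedVectors (truncate f d) ↔ ∑ c, ν c ≤ d ∧ ν ∈ inducedVectors f := by
  simp only [inducedVectors, truncate, Set.mem_ofPred_eq]
  split_ifs with h <;> simp [h]

theorem IsHereditary.truncate {C : Type*} [Fintype C] {f : (C → ℕ) → EReal}
    (hf : IsHereditary (inducedVectors f)) (d : ℕ) :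
    IsHereditary (inducedVectors (truncate f d)) := by
  refine ⟨mem_inducedVectors_truncate.2 ⟨by simp, hf.1⟩, fun ν ν' hlt hν => ?_⟩
  rw [mem_inducedVectors_truncate] at hν ⊢
  exact ⟨(Finset.sum_le_sum fun c _ => hlt.le c).trans hν.1, hf.mono hlt.le hν.2⟩

theorem IsHereditary.residualConstraint {S C : Type*} [DecidableEq C] {f : (C → ℕ) → EReal}
    (hf : IsHereditary (inducedVectors f)) {Y : Finset (S × C)}
    (hY : countVec Y ∈ inducedVectors f) :
    IsHereditary (inducedVectors (residualConstraint f Y)) := by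
  refine ⟨?_, fun ν ν' hlt hν => ?_⟩
  · simpa [inducedVectors, _root_.residualConstraint] using hY
  · exact hf.mono (add_le_add_left hlt.le (countVec Y)) hν

end constraints

/-! ### The students' choice and matchings. -/

namespace Market

variable {S C : Type*} (M : Market S C)

variable {M} in
theorem mem_chS {Y : Finset (S × C)} {x : S × C} :
    x ∈ M.chS Y ↔ x ∈ Y ∧ M.Acceptable x.1 x.2 ∧
      ∀ c, (x.1, c) ∈ Y → M.Acceptable x.1 c → c = x.2 ∨ M.sPref x.1 (some x.2) (some c) := by
  classical
  simp [chS]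

variable {M} in
theorem sPref_asymm {s : S} {c c' : C} (hc : (s, c) ∈ M.X) (hc' : (s, c') ∈ M.X)
    (h : M.sPref s (some c) (some c')) : ¬ M.sPref s (some c') (some c) := fun h' =>
  (M.sPref_strict s).1 (some c) (by simpa using hc)
    ((M.sPref_strict s).2.1 (some c) (by simpa using hc) (some c') (by simpa using hc')
      (some c) (by simpa using hc) h h')

theorem chS_fst_inj {Y : Finset (S × C)} {x y : S × C} (hx : x ∈ M.chS Y) (hy : y ∈ M.chS Y)
    (h : x.1 = y.1) : x = y := by
  obtain ⟨s, c⟩ := x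
  obtain ⟨s', c'⟩ := y
  obtain rfl : s = s' := h
  rw [mem_chS] at hx hy
  rcases hx.2.2 c' hy.1 hy.2.1 with h1 | h1
  · exact congrArg _ h1.symm
  · rcases hy.2.2 c hx.1 hx.2.1 with h2 | h2
    · exact congrArg _ h2
    · exact absurd h2 (sPref_asymm hx.2.1.1 hy.2.1.1 h1)

theorem card_chS_le [DecidableEq S] {Y : Finset (S × C)} {T : List S}
    (hT : ∀ x ∈ Y, x.1 ∈ T) : (M.chS Y).card ≤ T.length :=
  (Finset.card_le_card_of_injOn (t := T.toFinset) Prod.fst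
    (fun x hx => by simpa using hT x (M.chS_subset Y hx))
    (fun _ hx _ hy h => M.chS_fst_inj hx hy h)).trans (List.toFinset_card_le T)

/-- A student with an acceptable contract in `Y` gets one that is at least as good. -/
theorem exists_mem_chS {Y : Finset (S × C)} {s : S} {c : C} (hY : (s, c) ∈ Y)
    (hc : M.Acceptable s c) :
    ∃ c', (s, c') ∈ M.chS Y ∧ (c = c' ∨ M.sPref s (some c') (some c)) := by
  classical
  let A : Set C := {c | (s, c) ∈ Y ∧ M.Acceptable s c}
  have hfin : A.Finite :=
    (Y.image Prod.snd).finite_toSet.subset fun c hc => by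
      simpa using ⟨s, hc.1⟩
  let r : A → A → Prop := fun a b => M.sPref s (some a.1) (some b.1)
  have : Finite A := hfin
  have hirr : Std.Irrefl r := ⟨fun a h => sPref_asymm a.2.2.1 a.2.2.1 h h⟩
  have htr : IsTrans A r := ⟨fun a b c' hab hbc =>
    (M.sPref_strict s).2.1 (some a.1) (by simpa using a.2.2.1) (some b.1)
      (by simpa using b.2.2.1) (some c'.1) (by simpa using c'.2.2.1) hab hbc⟩
  have hwf : WellFounded r := Finite.wellFounded_of_trans_of_irrefl r
  -- `r a b` says that `a` is preferred, so a minimal element is a best one.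
  obtain ⟨m, -, hm⟩ := hwf.has_min Set.univ ⟨⟨c, hY, hc⟩, trivial⟩
  have hbest : ∀ c', (s, c') ∈ Y → M.Acceptable s c' →
      c' = m.1 ∨ M.sPref s (some m.1) (some c') := by
    intro c' h1 h2
    by_cases he : c' = m.1
    · exact Or.inl he
    · exact Or.inr (((M.sPref_strict s).2.2 (some m.1) (by simpa using m.2.2.1) (some c')
        (by simpa using h2.1) (fun h => he (Option.some.inj h).symm)).resolve_right
        (hm ⟨c', h1, h2⟩ trivial))
  exact ⟨m.1, mem_chS.2 ⟨m.2.1, m.2.2, hbest⟩, hbest c hY hc⟩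

theorem not_prefersTo_chS [DecidableEq S] {Y : Finset (S × C)} {s : S} {c : C}
    (hY : (s, c) ∈ Y) (hc : M.Acceptable s c) : ¬ M.PrefersTo s c (M.chS Y) := by
  obtain ⟨c', hc', hle⟩ := M.exists_mem_chS hY hc
  have hX' := (mem_chS.1 hc').2.1.1
  have hmem : (s, c') ∈ (M.chS Y).filter (fun x => x.1 = s) := Finset.mem_filter.2 ⟨hc', rfl⟩
  rintro (⟨c₁, h1, h2⟩ | ⟨h1, -⟩)
  · rw [h1, Finset.mem_singleton, Prod.mk.injEq] at hmem
    obtain ⟨-, rfl⟩ := hmem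
    rcases hle with rfl | hlt
    · exact sPref_asymm hX' hX' h2 h2
    · exact sPref_asymm hX' hc.1 hlt h2
  · simp [h1] at hmem

theorem isMatching_chS [DecidableEq S] (Y : Finset (S × C)) : M.IsMatching (M.chS Y) := by
  refine ⟨fun x hx => (mem_chS.1 hx).2.1.1, fun s => ?_⟩
  rcases Finset.eq_empty_or_nonempty ((M.chS Y).filter (fun x => x.1 = s)) with h | ⟨⟨s', c⟩, h⟩
  · exact Or.inl h
  · obtain ⟨hm, rfl⟩ := Finset.mem_filter.1 h
    refine Or.inr ⟨c, ?_, (mem_chS.1 hm).2.1⟩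
    refine Finset.eq_singleton_iff_unique_mem.2 ⟨h, fun y hy => ?_⟩
    obtain ⟨hy, hys⟩ := Finset.mem_filter.1 hy
    exact M.chS_fst_inj hy hm hys

theorem isMatching_union [DecidableEq S] [DecidableEq C] {Y Z : Finset (S × C)}
    (hY : M.IsMatching Y) (hZ : M.IsMatching Z) (h : ∀ x ∈ Y, ∀ z ∈ Z, x.1 ≠ z.1) :
    M.IsMatching (Y ∪ Z) := by
  refine ⟨Finset.union_subset hY.1 hZ.1, fun s => ?_⟩
  rw [Finset.filter_union]
  by_cases hs : Z.filter (fun x => x.1 = s) = ∅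
  · rw [hs, Finset.union_empty]
    exact hY.2 s
  · have : Y.filter (fun x => x.1 = s) = ∅ := by
      obtain ⟨z, hz⟩ := Finset.nonempty_iff_ne_empty.2 hs
      rw [Finset.mem_filter] at hz
      exact Finset.filter_eq_empty_iff.2 fun x hx hxs => h x hx z hz.1 (hxs.trans hz.2.symm)
    rw [this, Finset.empty_union]
    exact hZ.2 s

/-! ### GDA in one stage. -/

variable [DecidableEq S] [DecidableEq C]

/-- GDA ends with the students' choice from the contracts outside a set of rejected contracts, which
are all blocked by a set of fewer than `d` contracts of the outcome. -/
theorem gdaFrom_spec {g : (C → ℕ) → EReal} (hg : ∀ ν, g ν = ⊥ ∨ g ν = 0)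
    (hF : IsHereditary (inducedVectors g)) (hconv : IsMNatConvex (inducedVectors g))
    {w : S × C → ℝ} (hw : M.IsWeight w) (A : Finset (S × C)) (d : ℕ)
    (hcard : ∀ Re, (M.chS (A \ Re)).card ≤ d) (Re : Finset (S × C)) :
    ∀ Z ⊆ M.chS (A \ Re), countVec Z ∈ inducedVectors g →
      (∀ x ∈ Re, Z.card < d ∧
        countVec (Z.filter fun z => w x < w z) + Pi.single x.2 1 ∉ inducedVectors g) →
      ∃ Re' Z', M.gdaFrom g w A Re = M.chS (A \ Re') ∧ Z' ⊆ M.chS (A \ Re') ∧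
        countVec (M.chS (A \ Re')) ∈ inducedVectors g ∧
        ∀ x ∈ Re', Z'.card < d ∧
          countVec (Z'.filter fun z => w x < w z) + Pi.single x.2 1 ∉ inducedVectors g := by
  induction Re using gdaFrom.induct (M := M) (f := g) (w := w) (A := A) with
  | case1 Re h =>
    intro Z hZ _ hblock
    refine ⟨Re, Z, ?_, hZ, ?_, hblock⟩
    · rw [gdaFrom, if_pos h]
    · have := (isMaxWeight_chC hg hF.1 w (M.chS (A \ Re))).2.1
      rwa [h] at this
  | case2 Re h ih =>
    intro Z hZ hZF hblock
    rw [gdaFrom, if_neg h]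
    have hmax := isMaxWeight_chC hg hF.1 w (M.chS (A \ Re))
    have hX : ∀ x ∈ M.chS (A \ Re), x ∈ M.X := fun x hx => (mem_chS.1 hx).2.1.1
    have hpos : ∀ x ∈ M.chS (A \ Re), 0 < w x := fun x hx => hw.1 x (hX x hx)
    have hinj : ∀ x ∈ M.chS (A \ Re), ∀ y ∈ M.chS (A \ Re), w x = w y → x = y :=
      fun x hx y hy => hw.2.1 x (hX x hx) y (hX y hy)
    refine ih (chC g w (M.chS (A \ Re))) (fun x hx => ?_) hmax.2.1 fun x hx => ⟨?_, ?_⟩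
    -- Accepted contracts are proposed again: they stay available while the alternatives only
    -- shrink.
    · obtain ⟨h1, h2, h3⟩ := mem_chS.1 (hmax.1 hx)
      rw [Finset.mem_sdiff] at h1
      refine mem_chS.2 ⟨?_, h2, fun c hc => h3 c ?_⟩
      · simp [h1.1, h1.2, hx]
      · rw [Finset.mem_sdiff, Finset.mem_union, not_or] at hc
        exact Finset.mem_sdiff.2 ⟨hc.1, hc.2.1⟩
    -- A rejection makes the choice a proper subset of at most `d` proposals.
    · exact (Finset.card_lt_card (Finset.ssubset_iff_subset_ne.2 ⟨hmax.1, h⟩)).trans_le (hcard Re)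
    · rcases Finset.mem_union.1 hx with hx | hx
      · exact hmax.blocked_of_blocked hF hconv hpos hinj
          ((Finset.filter_subset _ _).trans hZ) (fun y hy => (Finset.mem_filter.1 hy).2)
          (hF.mono (countVec_mono (Finset.filter_subset _ _)) hZF) (hblock x hx).2
      · rw [Finset.mem_sdiff] at hx
        exact hmax.blocked hconv hpos hinj hx.1 hx.2

/-- Fullness is stated for `f`, not for its truncation, so that it still binds in later stages. -/
theorem gda_spec [Fintype C] {f : (C → ℕ) → EReal} (hf : ∀ ν, f ν = ⊥ ∨ f ν = 0)
    (hF : IsHereditary (inducedVectors f)) {d : ℕ}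
    (hconv : IsMNatConvex (inducedVectors (truncate f d)))
    {w : S × C → ℝ} (hw : M.IsWeight w) (T : List S) (hT : T.length ≤ d) :
    M.IsMatching (M.gda (truncate f d) w T) ∧
    (∀ x ∈ M.gda (truncate f d) w T, x.1 ∈ T) ∧
    countVec (M.gda (truncate f d) w T) ∈ inducedVectors f ∧
    ∀ s ∈ T, ∀ c, M.Acceptable s c → M.PrefersTo s c (M.gda (truncate f d) w T) →
      countVec (M.gda (truncate f d) w T) + Pi.single c 1 ∉ inducedVectors f ∧
      ∀ s', (s', c) ∈ M.gda (truncate f d) w T → w (s, c) ≤ w (s', c) := by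
  have hA : ∀ Re : Finset (S × C), ∀ x ∈ (M.X.filter (fun x => x.1 ∈ T)) \ Re, x.1 ∈ T :=
    fun Re x hx => (Finset.mem_filter.1 (Finset.mem_sdiff.1 hx).1).2
  have hFd := hF.truncate d
  obtain ⟨Re, Z, hR, hZ, hRF, hblock⟩ := M.gdaFrom_spec (truncate_values hf d) hFd
    hconv hw (M.X.filter (fun x => x.1 ∈ T)) d (fun Re => (M.card_chS_le (hA Re)).trans hT) ∅ ∅
    (Finset.empty_subset _) (by simpa using hFd.1) (by simp)
  rw [gda, hR]
  refine ⟨M.isMatching_chS _, fun x hx => hA Re x (M.chS_subset _ hx),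
    (mem_inducedVectors_truncate.1 hRF).2, fun s hs c hc hpref => ?_⟩
  have hRe : (s, c) ∈ Re := by
    by_contra hn
    exact M.not_prefersTo_chS (Finset.mem_sdiff.2 ⟨Finset.mem_filter.2 ⟨hc.1, hs⟩, hn⟩) hc hpref
  obtain ⟨hcard, hb⟩ := hblock _ hRe
  have hsub := Finset.filter_subset (fun z => w (s, c) < w z) Z
  refine ⟨fun h => hb ?_, fun s' hs' => ?_⟩
  · refine mem_inducedVectors_truncate.2 ⟨?_, hF.mono
      (add_le_add_left (countVec_mono (hsub.trans hZ)) _) h⟩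
    -- As `Z` has fewer than `d` contracts, one more unit respects the size bound.
    simp only [Pi.add_apply, Finset.sum_add_distrib, sum_countVec, Finset.sum_pi_single',
      Finset.mem_univ, if_true]
    have := Finset.card_le_card hsub
    omega
  · by_contra! hlt
    refine hb ?_
    have hn : (s', c) ∉ Z.filter (fun z => w (s, c) < w z) :=
      fun h => hlt.not_gt (Finset.mem_filter.1 h).2
    rw [← countVec_insert hn]
    exact hFd.mono (countVec_mono (Finset.insert_subset hs' (hsub.trans hZ))) hRF

/-! ### Composition of the stages. -/

variable {M}

/-- Positions refer to the remaining list, where students matched in `Y` no longer occur; hence the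
separate alternative `(s', c) ∈ Y`, which is void at the start. -/
theorem MSGDAFrom.spec [Fintype C] (hf : IsHereditary (inducedVectors M.f))
    {w : S × C → ℝ} (hw : M.IsWeight w) {L : List S} {Y Y' : Finset (S × C)}
    (h : M.MSGDAFrom w L Y Y') (hL : L.Nodup) (hY : M.IsMatching Y)
    (hYF : countVec Y ∈ inducedVectors M.f) (hYL : ∀ x ∈ Y, x.1 ∉ L) :
    Y ⊆ Y' ∧ M.IsMatching Y' ∧ countVec Y' ∈ inducedVectors M.f ∧
    (∀ x ∈ Y', x ∉ Y → x.1 ∈ L) ∧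
    ∀ s ∈ L, ∀ s' c, M.Acceptable s c → M.PrefersTo s c Y' → (s', c) ∈ Y' →
      M.cPref c (some s) (some s') → (s', c) ∈ Y ∨ L.idxOf s' < L.idxOf s := by
  induction h with
  | terminate Y =>
    exact ⟨Finset.Subset.refl _, hY, hYF, fun x hx hn => absurd hx hn, by simp⟩
  | stage L Y Y' d _ _ hconv _ ih =>
    have hres := hf.residualConstraint hYF
    obtain ⟨hRM, hRT, hRF, hRblock⟩ := M.gda_spec (fun ν => M.f_values _) hres hconv hw
      (L.take d) (List.length_take_le d L)
    set R := M.gda (truncate (residualConstraint M.f Y) d) w (L.take d)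
    have hdisj : ∀ s ∈ L.take d, s ∉ L.drop d := fun s h1 h2 =>
      List.disjoint_take_drop hL le_rfl h1 h2
    have hYR : ∀ x ∈ Y, ∀ z ∈ R, x.1 ≠ z.1 := fun x hx z hz he =>
      hYL x hx (he ▸ List.mem_of_mem_take (hRT z hz))
    have hcount : countVec (Y ∪ R) = countVec R + countVec Y := by
      rw [countVec_union (Finset.disjoint_left.2 fun x hx hz => hYR x hx x hz rfl), add_comm]
    obtain ⟨h1, h2, h3, h4, h5⟩ := ih (hL.sublist (List.drop_sublist d L))
      (M.isMatching_union hY hRM hYR) (by rw [hcount]; exact hRF) (fun x hx hxL => by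
        rcases Finset.mem_union.1 hx with hx | hx
        · exact hYL x hx (List.mem_of_mem_drop hxL)
        · exact hdisj _ (hRT x hx) hxL)
    refine ⟨Finset.subset_union_left.trans h1, h2, h3, fun x hx hxY => ?_, ?_⟩
    · by_cases hxR : x ∈ R
      · exact List.mem_of_mem_take (hRT x hxR)
      · exact List.mem_of_mem_drop (h4 x hx (by simp [hxY, hxR]))
    intro s hs s' c hacc hpref hs' hc
    rw [← List.take_append_drop d L, List.mem_append] at hs
    rw [← List.take_append_drop d L]
    rcases hs with hs | hs
    · have hfilter : Y'.filter (fun x => x.1 = s) = R.filter (fun x => x.1 = s) := by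
        ext x
        simp only [Finset.mem_filter, and_congr_left_iff]
        rintro rfl
        refine ⟨fun hx => ?_, fun hx => h1 (Finset.mem_union_right _ hx)⟩
        by_contra hxR
        by_cases hxY : x ∈ Y
        · exact hYL x hxY (List.mem_of_mem_take hs)
        · exact hdisj _ hs (h4 x hx (by simp [hxY, hxR]))
      have hprefR : M.PrefersTo s c R := by
        unfold PrefersTo at hpref ⊢
        rwa [hfilter] at hpref
      obtain ⟨hfull, hle⟩ := hRblock s hs c hacc hprefR
      left
      by_contra hsY
      by_cases hsR : (s', c) ∈ R
      · exact (hle s' hsR).not_gt (hw.2.2 s s' c hacc.1 (hRM.1 hsR) hc)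
      · refine hfull ?_
        -- A contract at `c` from a later stage would make `R` with one more unit at `c` feasible,
        -- by heredity from `Y'`.
        have hn : (s', c) ∉ Y ∪ R := by simp [hsY, hsR]
        have := hf.mono (countVec_mono (Finset.insert_subset hs' h1)) h3
        rw [countVec_insert hn, hcount, add_right_comm] at this
        exact this
    · have hsT : s ∉ L.take d := fun h => hdisj s h hs
      rcases h5 s hs s' c hacc hpref hs' hc with h | h
      · rcases Finset.mem_union.1 h with h | h
        · exact Or.inl h
        · right
          have hsT' := hRT _ h
          rw [List.idxOf_append_of_mem hsT', List.idxOf_append_of_notMem hsT]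
          exact (List.idxOf_lt_length_of_mem hsT').trans_le (Nat.le_add_right _ _)
      · right
        rw [List.idxOf_append_of_notMem hsT]
        by_cases hsT' : s' ∈ L.take d
        · rw [List.idxOf_append_of_mem hsT']
          exact (List.idxOf_lt_length_of_mem hsT').trans_le (Nat.le_add_right _ _)
        · rw [List.idxOf_append_of_notMem hsT']
          omega

end Market

theorem mainTheorem3 {S C : Type*} [Fintype S] [DecidableEq S] [Fintype C] [DecidableEq C]
    (M : Market S C) (hf : IsHereditary (inducedVectors M.f))
    (w : S × C → ℝ) (hw : M.IsWeight w)
    (L : List S) (hL_nodup : L.Nodup) (hL_mem : ∀ s, s ∈ L)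
    (Y : Finset (S × C)) (hY : M.IsMSGDAOutput w L Y) :
    M.IsMatching Y ∧ M.MLFair L Y := by
  obtain ⟨-, hM, -, -, hfair⟩ := Market.MSGDAFrom.spec hf hw hY hL_nodup
    ⟨Finset.empty_subset _, fun s => Or.inl (by simp)⟩ (by simpa using hf.1) (by simp)
  refine ⟨hM, fun s s' ⟨c, hacc, hpref, hs', hc⟩ => ?_⟩
  exact (hfair s (hL_mem s) s' c hacc hpref hs' hc).resolve_left (by simp)
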